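/- Let $n\ge 4$, $r\ge 0$ and $k\ge 0$ be integers, let $s_1,\dots,s_k$ be integers with $0\le s_i\le n-1$, and let $a_1,\dots,a_k$ and $\lambda_1,\dots,\lambda_k$ be positive real numbers. Let $$c_{n,r}=\frac{1}{|\mathbb{S}^{n-1}|}\int_{\mathbb{S}^{n-1}} y_1^{2r}\,d\rho(y),$$ where $\rho$ is the surface measure on the unit sphere $\mathbb{S}^{n-1}\subset\mathbb{R}^n$ and $|\mathbb{S}^{n-1}|$ is its surface area. Suppose that the identity $$c_{n,r}\,(X_1^2+\cdots+X_n^2)^r=\sum_{i=1}^k\lambda_i\sum_{\sigma\in\mathcal{S}_n}\ \sum_{\varepsilon\in\{\pm1\}^{s_i}}\bigl(a_iX_{\sigma(1)}+\varepsilon_1X_{\sigma(2)}+\cdots+\varepsilon_{s_i}X_{\sigma(s_i+1)}\bigr)^{2r}$$ holds in the polynomial ring $\mathbb{R}[X_1,\dots,X_n]$, where $\mathcal{S}_n$ denotes the group of permutations of $\{1,\dots,n\}$. Then $r\le 7$. -/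

import Mathlib

open MeasureTheory

/-- The constant `c_{n,r}`: the mean value of `y₁ ^ (2 r)` over the unit sphere of `ℝⁿ` (here
`n ≥ 1`) with respect to the surface measure. -/
noncomputable def sphereMoment (n r : ℕ) (hn : 0 < n) : ℝ :=
  ⨍ y : Metric.sphere (0 : EuclideanSpace ℝ (Fin n)) 1,
    (y : EuclideanSpace ℝ (Fin n)) ⟨0, hn⟩ ^ (2 * r)
    ∂((volume : Measure (EuclideanSpace ℝ (Fin n))).toSphere)

/-- The linear form `a X_{σ(1)} ± X_{σ(2)} ± ⋯ ± X_{σ(s+1)}` in `n` variables, where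
`0 ≤ s ≤ n - 1` and `ε` lists the `s` signs. Variables are numbered from `0`. -/
noncomputable def cornerForm {n : ℕ} (a : ℝ) (s : Fin n) (σ : Equiv.Perm (Fin n))
    (ε : Fin (s : ℕ) → ℤˣ) : MvPolynomial (Fin n) ℝ :=
  MvPolynomial.C a * MvPolynomial.X (σ ⟨0, Nat.zero_lt_of_lt s.isLt⟩) +
    ∑ j : Fin (s : ℕ), MvPolynomial.C (((ε j : ℤˣ) : ℤ) : ℝ) *
      MvPolynomial.X (σ ⟨(j : ℕ) + 1, Nat.lt_of_le_of_lt (Nat.succ_le_of_lt j.isLt) s.isLt⟩)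

/-! Apply the order 8 operator with symbol `H = h(x₀, x₁) h(x₂, x₃)`, `h(x, y) = x y (x² - y²)`, to
both sides. On a power of a linear form it produces the factor `H(u)`, `u` being the coefficient
vector. The coefficient `a` meets at most one of the two pairs; on the other pair the entries lie in
`{-1, 0, 1}`, where `h` vanishes, so the right side dies. As `H` is harmonic, for `r ≥ 8` the left
side becomes a nonzero multiple of `H · |X|^(2(r - 8))`, a contradiction. -/

open MvPolynomial in
/-- The differential operator `∂ᵢ ∂ⱼ (∂ᵢ² - ∂ⱼ²)`, whose symbol `xᵢ xⱼ (xᵢ² - xⱼ²)` is harmonic. -/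
noncomputable def quarticOp {ι : Type*} (i j : ι) : MvPolynomial ι ℝ →ₗ[ℝ] MvPolynomial ι ℝ :=
  (pderiv i).toLinearMap ∘ₗ (pderiv j).toLinearMap ∘ₗ
    ((pderiv i).toLinearMap ∘ₗ (pderiv i).toLinearMap -
      (pderiv j).toLinearMap ∘ₗ (pderiv j).toLinearMap)

section
open MvPolynomial

variable {ι : Type*}

lemma quarticOp_apply (i j : ι) (f : MvPolynomial ι ℝ) :
    quarticOp i j f =
      pderiv i (pderiv j (pderiv i (pderiv i f) - pderiv j (pderiv j f))) := rfl

lemma quarticOp_C_mul (i j : ι) (c : ℝ) (f : MvPolynomial ι ℝ) :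
    quarticOp i j (C c * f) = C c * quarticOp i j f := by
  rw [← smul_eq_C_mul, map_smul, smul_eq_C_mul]

/-- On a power of a linear form, the operator acts by evaluating its symbol. -/
lemma quarticOp_linear_pow (i j : ι) {L : MvPolynomial ι ℝ} {u v : ℝ}
    (hu : pderiv i L = C u) (hv : pderiv j L = C v) (m : ℕ) :
    ∃ K : ℝ, quarticOp i j (L ^ m) = C (u * v * (u ^ 2 - v ^ 2)) * (C K * L ^ (m - 4)) := by
  have key : ∀ (l : ι) (w c : ℝ) (p : ℕ), pderiv l L = C w →
      pderiv l (C c * L ^ p) = C (c * p * w) * L ^ (p - 1) := by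
    intro l w c p h
    rw [pderiv_C_mul, pderiv_pow, h]
    simp only [map_mul, map_natCast]
    ring
  have hm : L ^ m = C 1 * L ^ m := by simp
  -- Truncated subtraction is harmless: for `m < 4` one of the factors is zero.
  refine ⟨m * ((m - 1 : ℕ) : ℝ) * ((m - 1 - 1 : ℕ) : ℝ) * ((m - 1 - 1 - 1 : ℕ) : ℝ), ?_⟩
  rw [quarticOp_apply, hm, key i u _ _ hu, key i u _ _ hu, key j v _ _ hv, key j v _ _ hv,
    ← sub_mul, ← C_sub, key j v _ _ hv, key i u _ _ hu, ← mul_assoc, ← C_mul]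
  congr 2
  ring

/-- The operator extracts its symbol from `f * q ^ (t + 4)` when `q` is the squared norm and `f` is
independent of the two variables involved. -/
lemma quarticOp_mul_sq_pow {i j : ι} (hij : i ≠ j) {f q : MvPolynomial ι ℝ}
    (hfi : pderiv i f = 0) (hfj : pderiv j f = 0)
    (hqi : pderiv i q = 2 * X i) (hqj : pderiv j q = 2 * X j) (t : ℕ) :
    quarticOp i j (f * q ^ (t + 4)) =
      C (16 * (t + 4) * (t + 3) * (t + 2) * (t + 1) : ℝ) *
        ((X i * X j * (X i ^ 2 - X j ^ 2)) * f * q ^ t) := by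
  have step : ∀ (l : ι) (g g' : MvPolynomial ι ℝ) (p : ℕ), pderiv l q = 2 * X l → pderiv l g = g' →
      pderiv l (g * q ^ (p + 1)) = g' * q ^ (p + 1) + g * (((p : MvPolynomial ι ℝ) + 1) * (2 * X l)) * q ^ p := by
    intro l g g' p h hg
    rw [pderiv_mul, pderiv_pow, h, hg, Nat.add_sub_cancel, Nat.cast_add, Nat.cast_one]
    ring
  have hC : ∀ (l : ι) (c : ℝ) (g g' : MvPolynomial ι ℝ), pderiv l g = g' →
      pderiv l (C c * g) = C c * g' := by
    intro l c g g' h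
    rw [pderiv_C_mul, h]
  have hmul : ∀ (l : ι) (g h : MvPolynomial ι ℝ), pderiv l g = 0 →
      pderiv l (g * h) = g * pderiv l h := by
    intro l g h hg
    rw [pderiv_mul, hg, zero_mul, zero_add]
  have twice : ∀ l : ι, pderiv l f = 0 → pderiv l q = 2 * X l →
      pderiv l (pderiv l (f * q ^ (t + 4))) =
        C (2 * (t + 4) : ℝ) * (f * q ^ (t + 3)) +
          C (4 * (t + 4) * (t + 3) : ℝ) * (f * X l ^ 2 * q ^ (t + 2)) := by
    intro l hf h
    have e : pderiv l (f * q ^ (t + 4)) = C (2 * (t + 4) : ℝ) * (f * X l) * q ^ (t + 2 + 1) := by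
      rw [step l f 0 (t + 3) h hf]
      simp only [map_mul, map_add, map_natCast, map_ofNat, Nat.cast_add, Nat.cast_ofNat]
      ring
    rw [e, step l _ (C (2 * (t + 4) : ℝ) * f) (t + 2) h
      (hC l _ _ _ (by rw [hmul l _ _ hf, pderiv_X_self, mul_one]))]
    simp only [map_mul, map_add, map_natCast, map_ofNat, Nat.cast_add, Nat.cast_ofNat]
    ring
  -- The `q ^ (t + 3)` terms of the two second derivatives cancel.
  have hdiff : pderiv i (pderiv i (f * q ^ (t + 4))) - pderiv j (pderiv j (f * q ^ (t + 4))) =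
      C (4 * (t + 4) * (t + 3) : ℝ) * (f * (X i ^ 2 - X j ^ 2)) * q ^ (t + 1 + 1) := by
    rw [twice i hfi hqi, twice j hfj hqj]
    ring
  have hsqi : pderiv i (X i ^ 2 - X j ^ 2 : MvPolynomial ι ℝ) = 2 * X i := by
    simp [pderiv_X_of_ne hij.symm]
  have hsqj : pderiv j (X i ^ 2 - X j ^ 2 : MvPolynomial ι ℝ) = -(2 * X j) := by
    simp [pderiv_X_of_ne hij]
  have hthird : pderiv j (C (4 * (t + 4) * (t + 3) : ℝ) * (f * (X i ^ 2 - X j ^ 2)) *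
      q ^ (t + 1 + 1)) =
      C (8 * (t + 4) * (t + 3) : ℝ) * ((f * -X j) * q ^ (t + 1 + 1)) +
        C (8 * (t + 4) * (t + 3) * (t + 2) : ℝ) *
          ((f * X j) * (X i ^ 2 - X j ^ 2) * q ^ (t + 1)) := by
    rw [step j _ _ (t + 1) hqj (hC j _ _ _ ((hmul j _ _ hfj).trans (by rw [hsqj])))]
    simp only [map_mul, map_add, map_natCast, map_ofNat, Nat.cast_add, Nat.cast_one]
    ring
  have hfj' : pderiv i (f * -X j) = 0 := by
    rw [hmul i _ _ hfi, map_neg, pderiv_X_of_ne hij.symm, neg_zero, mul_zero]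
  have hfj'' : pderiv i (f * X j) = 0 := by
    rw [hmul i _ _ hfi, pderiv_X_of_ne hij.symm, mul_zero]
  rw [quarticOp_apply, hdiff, hthird, map_add,
    hC i _ _ _ (step i _ _ (t + 1) hqi hfj'),
    hC i _ _ _ (step i _ _ t hqi ((hmul i _ _ hfj'').trans (by rw [hsqi])))]
  -- The two `q ^ (t + 1)` terms cancel, leaving only the symbol times `q ^ t`.
  simp only [map_mul, map_add, map_natCast, map_ofNat, map_one, Nat.cast_add, Nat.cast_one]
  ring

lemma pderiv_sum_X_sq [Fintype ι] (i : ι) :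
    pderiv i (∑ j : ι, (X j : MvPolynomial ι ℝ) ^ 2) = 2 * X i := by
  classical
  simp [map_sum, pderiv_X, Pi.single_apply]

/-- Applying the operator in two disjoint pairs of variables kills a power of a linear form on
which the symbol vanishes. -/
lemma quarticOp_quarticOp_linear_pow_eq_zero (i j l m : ι) {L : MvPolynomial ι ℝ} {u : ι → ℝ}
    (hL : ∀ x, pderiv x L = C (u x))
    (hu : u i * u j * (u i ^ 2 - u j ^ 2) * (u l * u m * (u l ^ 2 - u m ^ 2)) = 0) (p : ℕ) :
    quarticOp i j (quarticOp l m (L ^ p)) = 0 := by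
  obtain ⟨K, hK⟩ := quarticOp_linear_pow l m (hL l) (hL m) p
  obtain ⟨K', hK'⟩ := quarticOp_linear_pow i j (hL i) (hL j) (p - 4)
  rw [hK, quarticOp_C_mul, quarticOp_C_mul, hK', mul_left_comm (C K), ← mul_assoc, ← C_mul,
    mul_comm (u l * u m * _), hu, C_0, zero_mul]

/-- A power of the squared norm of exponent at least `8` is not killed by the operator in two
disjoint pairs of variables. -/
lemma quarticOp_quarticOp_sq_pow_ne_zero [Fintype ι] {i j l m : ι} (hij : i ≠ j) (hlm : l ≠ m)
    (hil : i ≠ l) (him : i ≠ m) (hjl : j ≠ l) (hjm : j ≠ m) (t : ℕ) :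
    quarticOp i j (quarticOp l m ((∑ x : ι, (X x : MvPolynomial ι ℝ) ^ 2) ^ (t + 8))) ≠ 0 := by
  classical
  have hne : ∀ {x y : ι}, x ≠ y → (X x * X y * (X x ^ 2 - X y ^ 2) : MvPolynomial ι ℝ) ≠ 0 := by
    intro x y hxy h
    have := congrArg (eval (fun z => if z = x then (2 : ℝ) else 1)) h
    norm_num [hxy.symm] at this
  have hq : (∑ x : ι, (X x : MvPolynomial ι ℝ) ^ 2) ≠ 0 := by
    intro h
    have := congrArg (pderiv i) h
    rw [pderiv_sum_X_sq, map_zero] at this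
    exact (mul_ne_zero two_ne_zero (X_ne_zero i)) this
  have hd : ∀ x : ι, x ≠ l → x ≠ m →
      pderiv x (X l * X m * (X l ^ 2 - X m ^ 2) : MvPolynomial ι ℝ) = 0 := by
    intro x hxl hxm
    simp [pderiv_X_of_ne hxl.symm, pderiv_X_of_ne hxm.symm]
  have h1 := quarticOp_mul_sq_pow (f := 1) hlm pderiv_one pderiv_one
    (pderiv_sum_X_sq l) (pderiv_sum_X_sq m) (t + 4)
  rw [one_mul, mul_one] at h1
  rw [h1, quarticOp_C_mul, quarticOp_mul_sq_pow hij (hd i hil him) (hd j hjl hjm)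
    (pderiv_sum_X_sq i) (pderiv_sum_X_sq j) t]
  refine mul_ne_zero (C_ne_zero.2 (by positivity)) (mul_ne_zero (C_ne_zero.2 (by positivity)) ?_)
  exact mul_ne_zero (mul_ne_zero (hne hij) (hne hlm)) (pow_ne_zero _ hq)

/-- Away from the variable carrying `a`, the coefficients of a corner form lie in `{-1, 0, 1}`. -/
lemma exists_pderiv_cornerForm {n : ℕ} (a : ℝ) (s : Fin n) (σ : Equiv.Perm (Fin n))
    (ε : Fin (s : ℕ) → ℤˣ) :
    ∃ (y : Fin n) (u : Fin n → ℝ), (∀ x, pderiv x (cornerForm a s σ ε) = C (u x)) ∧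
      ∀ x, x ≠ y → u x ^ 3 = u x := by
  refine ⟨σ ⟨0, Nat.zero_lt_of_lt s.isLt⟩, fun x =>
    a * (if σ ⟨0, Nat.zero_lt_of_lt s.isLt⟩ = x then 1 else 0) +
      ∑ j : Fin (s : ℕ), (((ε j : ℤˣ) : ℤ) : ℝ) *
        (if σ ⟨(j : ℕ) + 1, Nat.lt_of_le_of_lt (Nat.succ_le_of_lt j.isLt) s.isLt⟩ = x
          then 1 else 0), fun x => ?_, fun x hx => ?_⟩
  · have hX : ∀ z : Fin n, pderiv x (X z : MvPolynomial (Fin n) ℝ) =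
        C (if z = x then 1 else 0) := by
      intro z
      by_cases hz : z = x
      · subst hz; simp
      · rw [pderiv_X_of_ne hz, if_neg hz, C_0]
    simp only [cornerForm, map_add, map_sum, pderiv_C_mul, hX, C_mul]
  · simp only [if_neg hx.symm, mul_zero, zero_add]
    by_cases h : ∃ j : Fin (s : ℕ),
        σ ⟨(j : ℕ) + 1, Nat.lt_of_le_of_lt (Nat.succ_le_of_lt j.isLt) s.isLt⟩ = x
    · obtain ⟨j, rfl⟩ := h
      -- By injectivity of `σ`, only one index hits the variable.
      rw [Finset.sum_eq_single j (fun b _ hb => ?_) (by simp)]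
      · rcases Int.units_eq_one_or (ε j) with h | h <;> norm_num [h]
      · rw [if_neg, mul_zero]
        simpa [Fin.ext_iff] using hb
    · rw [Finset.sum_eq_zero fun j _ => ?_]
      · norm_num
      · rw [if_neg fun hj => h ⟨j, hj⟩, mul_zero]

lemma quarticOp_quarticOp_cornerForm_pow {n : ℕ} {i j l m : Fin n}
    (hil : i ≠ l) (him : i ≠ m) (hjl : j ≠ l) (hjm : j ≠ m) (a : ℝ) (s : Fin n)
    (σ : Equiv.Perm (Fin n)) (ε : Fin (s : ℕ) → ℤˣ) (p : ℕ) :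
    quarticOp i j (quarticOp l m (cornerForm a s σ ε ^ p)) = 0 := by
  obtain ⟨y, u, hL, hu⟩ := exists_pderiv_cornerForm a s σ ε
  have hz : ∀ x z, x ≠ y → z ≠ y → u x * u z * (u x ^ 2 - u z ^ 2) = 0 := by
    intro x z hx hz
    linear_combination u z * hu x hx - u x * hu z hz
  refine quarticOp_quarticOp_linear_pow_eq_zero i j l m hL ?_ p
  -- The pairs are disjoint, so at least one avoids `y`.
  by_cases h : i ≠ y ∧ j ≠ y
  · rw [hz i j h.1 h.2, zero_mul]
  · rw [hz l m (by grind) (by grind), mul_zero]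

end

/-- The integrand is continuous, nonnegative and equal to 1 at the first basis vector. -/
lemma sphereMoment_pos (n r : ℕ) (hn : 0 < n) : 0 < sphereMoment n r hn := by
  have : Nonempty (Fin n) := ⟨⟨0, hn⟩⟩
  have : Nontrivial (EuclideanSpace ℝ (Fin n)) := inferInstance
  let e : Metric.sphere (0 : EuclideanSpace ℝ (Fin n)) 1 :=
    ⟨EuclideanSpace.single ⟨0, hn⟩ 1, by simp⟩
  have hc : Continuous fun y : Metric.sphere (0 : EuclideanSpace ℝ (Fin n)) 1 =>
      (y : EuclideanSpace ℝ (Fin n)) ⟨0, hn⟩ ^ (2 * r) := by fun_prop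
  rw [sphereMoment, average_eq, smul_eq_mul]
  refine mul_pos (inv_pos.2 ?_) ?_
  · exact ENNReal.toReal_pos ((Measure.measure_univ_ne_zero).2 (Measure.toSphere_ne_zero _))
      (measure_ne_top _ _)
  · refine hc.integral_pos_of_hasCompactSupport_nonneg_nonzero (x := e)
      (HasCompactSupport.of_compactSpace _) (fun y => ?_) ?_
    · exact (even_two_mul r).pow_nonneg _
    · simp [e]

theorem corollary3p3 (n r k : ℕ) (hn : 4 ≤ n)
    (a : Fin k → ℝ) (ha : ∀ i, 0 < a i)
    (s : Fin k → Fin n)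
    (w : Fin k → ℝ) (hw : ∀ i, 0 < w i)
    (hid : MvPolynomial.C (sphereMoment n r (by omega)) *
        (∑ j : Fin n, (MvPolynomial.X j : MvPolynomial (Fin n) ℝ) ^ 2) ^ r =
      ∑ i : Fin k, MvPolynomial.C (w i) *
        ∑ σ : Equiv.Perm (Fin n), ∑ ε : Fin (s i : ℕ) → ℤˣ,
          cornerForm (a i) (s i) σ ε ^ (2 * r)) :
    r ≤ 7 := by
  by_contra hr
  obtain ⟨t, rfl⟩ : ∃ t, r = t + 8 := ⟨r - 8, by omega⟩
  let v : Fin 4 → Fin n := Fin.castLE hn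
  have hv : ∀ {x y : Fin 4}, x ≠ y → v x ≠ v y := fun h h' => h (Fin.castLE_injective hn h')
  have h := congrArg (fun f => quarticOp (v 0) (v 1) (quarticOp (v 2) (v 3) f)) hid
  simp only [quarticOp_C_mul, map_sum] at h
  simp only [quarticOp_quarticOp_cornerForm_pow (hv (by decide : (0 : Fin 4) ≠ 2))
    (hv (by decide : (0 : Fin 4) ≠ 3)) (hv (by decide : (1 : Fin 4) ≠ 2))
    (hv (by decide : (1 : Fin 4) ≠ 3)), Finset.sum_const_zero, mul_zero] at h
  exact mul_ne_zero (MvPolynomial.C_ne_zero.2 (sphereMoment_pos n (t + 8) (by omega)).ne')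
    (quarticOp_quarticOp_sq_pow_ne_zero (hv (by decide)) (hv (by decide)) (hv (by decide))
      (hv (by decide)) (hv (by decide)) (hv (by decide)) t) h
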